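/- Let $T_L,D_L,a_L,T_R,D_R,a_R,b\in\mathbb{R}$ and consider the planar piecewise linear system in Li\'enard canonical form \[ \left\{\begin{array}{l}\dot x=T_Lx-y\\ \dot y=D_Lx-a_L\end{array}\right.\ \text{for } x<0,\qquad \left\{\begin{array}{l}\dot x=T_Rx-y+b\\ \dot y=D_Rx-a_R\end{array}\right.\ \text{for } x>0 . \] A crossing periodic orbit is the orbit of a periodic solution that meets the separation line $\Sigma=\{x=0\}$, and meets it only at crossing points, that is, at points outside the closed segment with endpoints $(0,0)$ and $(0,b)$ (the closure of the sliding region, which reduces to the tangency point $(0,0)$ if $b=0$); at such a point the solution passes from one zone to the other, each of the two arcs satisfying the system of its own zone up to $\Sigma$. Assume that $T_LT_R\geqslant 0$ and that at least one of the following two (non-exclusive) hypotheses holds: 1) $T_L\neq 0$ and $T_Lb\geqslant 0$; 2) $T_R\neq 0$ and $T_Rb\geqslant 0$. Then the system has no crossing periodic orbits. -/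

import Mathlib

/-- The real parameters of the planar piecewise linear system in Liénard canonical form
`x' = T_L x - y, y' = D_L x - a_L` for `x < 0` and
`x' = T_R x - y + b, y' = D_R x - a_R` for `x > 0`. -/
structure PiecewiseLienard where
  TL : ℝ
  DL : ℝ
  aL : ℝ
  TR : ℝ
  DR : ℝ
  aR : ℝ
  b : ℝ

namespace PiecewiseLienard

/-- The affine vector field of the left zone `x < 0`. -/
def leftField (S : PiecewiseLienard) (q : ℝ × ℝ) : ℝ × ℝ :=
  (S.TL * q.1 - q.2, S.DL * q.1 - S.aL)

/-- The affine vector field of the right zone `x > 0`. -/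
def rightField (S : PiecewiseLienard) (q : ℝ × ℝ) : ℝ × ℝ :=
  (S.TR * q.1 - q.2 + S.b, S.DR * q.1 - S.aR)

/-- `γ : ℝ → ℝ × ℝ` is a crossing solution: it is an integral curve of the left field in `x < 0`
and of the right field in `x > 0`, and it meets the separation line `x = 0` only at crossing
points, i.e. outside the closed segment joining the tangency points `(0, 0)` and `(0, b)`
(the closure of the sliding region).  Above that segment both fields point to the left, so there
the curve passes from the right zone to the left zone; below it, from left to right. The
one-sided derivatives say that each of the two arcs that meet at a crossing point solves the
system of its own zone up to the separation line. -/
structure IsCrossingSolution (S : PiecewiseLienard) (γ : ℝ → ℝ × ℝ) : Prop where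
  left : ∀ t, (γ t).1 < 0 → HasDerivAt γ (S.leftField (γ t)) t
  right : ∀ t, 0 < (γ t).1 → HasDerivAt γ (S.rightField (γ t)) t
  cross : ∀ t, (γ t).1 = 0 →
    (max 0 S.b < (γ t).2 ∧
      HasDerivWithinAt γ (S.rightField (γ t)) (Set.Iic t) t ∧
      HasDerivWithinAt γ (S.leftField (γ t)) (Set.Ici t) t) ∨
    ((γ t).2 < min 0 S.b ∧
      HasDerivWithinAt γ (S.leftField (γ t)) (Set.Iic t) t ∧
      HasDerivWithinAt γ (S.rightField (γ t)) (Set.Ici t) t)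

/-- A crossing periodic orbit: the trace of a periodic crossing solution that does meet the
separation line (so that it is not a closed orbit inside one open zone). -/
def IsCrossingPeriodicOrbit (S : PiecewiseLienard) (O : Set (ℝ × ℝ)) : Prop :=
  ∃ (γ : ℝ → ℝ × ℝ) (p : ℝ), 0 < p ∧ Function.Periodic γ p ∧ S.IsCrossingSolution γ ∧
    (∃ t, (γ t).1 = 0) ∧ O = Set.range γ

end PiecewiseLienard

open Filter Topology

/-! Each zone carries an energy `E = x' ^ 2 / 2 + D x ^ 2 / 2 - a x`, which changes along its flow
at the rate `T x' ^ 2`. On `x = 0` the left energy is `y ^ 2 / 2` and the right one `(y - b) ^ 2 /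
2`, so a crossing changes the energy by `b |y - b / 2|`, whichever way it goes: `y > b / 2` when
passing to the left, `y < b / 2` when passing to the right. The hypotheses give one `σ ≠ 0` with `σ
T_L`, `σ T_R`, `σ b` all nonnegative, so `σ E` is nondecreasing (`monotone_energy`) and, being
periodic, constant. Both arcs meeting at a crossing have `x' ≠ 0` there, so zero rates force both
traces to vanish (`traces_eq_zero_of_energy_const`), a contradiction. -/

/-- A real function that is nondecreasing on both sides of each point is monotone. -/
lemma monotone_of_eventually_le {f : ℝ → ℝ} (hl : ∀ t, ∀ᶠ s in 𝓝[<] t, f s ≤ f t)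
    (hr : ∀ t, ∀ᶠ s in 𝓝[>] t, f t ≤ f s) : Monotone f := by
  intro a b hab
  by_contra hlt
  -- Real induction, since `f` may jump: the left condition carries the bound to the supremum `c`,
  -- the right one pushes it past `c`.
  set A : Set ℝ := {s | s ∈ Set.Icc a b ∧ ∀ r ∈ Set.Icc a s, f a ≤ f r} with hA
  have haA : a ∈ A := ⟨⟨le_rfl, hab⟩, fun r hr => by rw [le_antisymm hr.2 hr.1]⟩
  have hbdd : BddAbove A := ⟨b, fun s hs => hs.1.2⟩
  set c := sSup A with hc
  have hac : a ≤ c := le_csSup hbdd haA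
  have hcb : c ≤ b := csSup_le ⟨a, haA⟩ fun s hs => hs.1.2
  have hbelow : ∀ r, a ≤ r → r < c → f a ≤ f r := fun r har hrc => by
    obtain ⟨s, hs, hrs⟩ := exists_lt_of_lt_csSup ⟨a, haA⟩ hrc
    exact hs.2 r ⟨har, hrs.le⟩
  have hfc : f a ≤ f c := by
    rcases hac.eq_or_lt with h | h
    · rw [← h]
    · obtain ⟨s, hs, hs'⟩ := ((hl c).and (Ioo_mem_nhdsLT h)).exists
      exact (hbelow s hs'.1.le hs'.2).trans hs
  rcases hcb.eq_or_lt with h | h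
  · exact hlt (h ▸ hfc)
  · obtain ⟨u, hu, hu'⟩ := (mem_nhdsGT_iff_exists_Ioo_subset' h).1 (hr c)
    obtain ⟨v, hv, hv'⟩ := exists_between (lt_min hu h)
    have hvA : v ∈ A := by
      refine ⟨⟨hac.trans hv.le, (hv'.trans_le (min_le_right _ _)).le⟩, fun r hr => ?_⟩
      rcases lt_trichotomy r c with h1 | h1 | h1
      · exact hbelow r hr.1 h1
      · rwa [h1]
      · exact hfc.trans (hu' ⟨h1, hr.2.trans_lt (hv'.trans_le (min_le_left _ _))⟩)
    exact absurd (le_csSup hbdd hvA) (not_le.2 hv)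

/-- A monotone periodic real function is constant. -/
lemma Monotone.eq_of_periodic {f : ℝ → ℝ} {p : ℝ} (hf : Monotone f) (hp : 0 < p)
    (hper : Function.Periodic f p) (s t : ℝ) : f s = f t := by
  have key : ∀ s t, f s ≤ f t := fun s t => by
    -- Shifting `t` by `n` periods puts it to the right of `s`.
    obtain ⟨n, hn⟩ := Archimedean.arch (s - t) hp
    rw [← hper.nsmul n t]
    exact hf (by linarith)
  exact le_antisymm (key s t) (key t s)

lemma HasDerivWithinAt.eventually_pos_nhdsGT {f : ℝ → ℝ} {f' t : ℝ}
    (h : HasDerivWithinAt f f' (Set.Ici t) t) (h0 : f t = 0) (hf' : 0 < f') :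
    ∀ᶠ s in 𝓝[>] t, 0 < f s := by
  have h1 := (hasDerivWithinAt_iff_tendsto_slope' (s := Set.Ioi t) (lt_irrefl t)).1
    (h.mono Set.Ioi_subset_Ici_self)
  filter_upwards [h1.eventually (lt_mem_nhds hf'), self_mem_nhdsWithin] with s hs hst
  rw [slope_def_field, h0, sub_zero] at hs
  exact (div_pos_iff_of_pos_right (sub_pos.2 hst)).1 hs

lemma HasDerivWithinAt.eventually_neg_nhdsLT {f : ℝ → ℝ} {f' t : ℝ}
    (h : HasDerivWithinAt f f' (Set.Iic t) t) (h0 : f t = 0) (hf' : 0 < f') :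
    ∀ᶠ s in 𝓝[<] t, f s < 0 := by
  have h1 := (hasDerivWithinAt_iff_tendsto_slope' (s := Set.Iio t) (lt_irrefl t)).1
    (h.mono Set.Iio_subset_Iic_self)
  filter_upwards [h1.eventually (lt_mem_nhds hf'), self_mem_nhdsWithin] with s hs hst
  rw [slope_def_field, h0, sub_zero] at hs
  by_contra hn
  exact absurd hs (not_lt.2 (div_nonpos_of_nonneg_of_nonpos (not_lt.1 hn) (sub_neg.2 hst).le))

/-! ### Energy of a single affine Liénard system -/

/-- The energy `x' ^ 2 / 2 + D x ^ 2 / 2 - a x` of the affine Liénard system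
`x' = T x - y + b, y' = D x - a`. -/
noncomputable def lienardEnergy (T D a b : ℝ) (q : ℝ × ℝ) : ℝ :=
  (T * q.1 - q.2 + b) ^ 2 / 2 + D * q.1 ^ 2 / 2 - a * q.1

lemma continuous_lienardEnergy (T D a b : ℝ) : Continuous (lienardEnergy T D a b) := by
  unfold lienardEnergy
  fun_prop

lemma HasDerivWithinAt.prod_fst {γ : ℝ → ℝ × ℝ} {v : ℝ × ℝ} {s : Set ℝ} {t : ℝ}
    (h : HasDerivWithinAt γ v s t) : HasDerivWithinAt (fun r => (γ r).1) v.1 s t :=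
  (ContinuousLinearMap.fst ℝ ℝ ℝ).hasFDerivAt.comp_hasDerivWithinAt t h

lemma HasDerivAt.prod_fst {γ : ℝ → ℝ × ℝ} {v : ℝ × ℝ} {t : ℝ}
    (h : HasDerivAt γ v t) : HasDerivAt (fun r => (γ r).1) v.1 t :=
  (ContinuousLinearMap.fst ℝ ℝ ℝ).hasFDerivAt.comp_hasDerivAt t h

lemma HasDerivAt.prod_snd {γ : ℝ → ℝ × ℝ} {v : ℝ × ℝ} {t : ℝ}
    (h : HasDerivAt γ v t) : HasDerivAt (fun r => (γ r).2) v.2 t :=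
  (ContinuousLinearMap.snd ℝ ℝ ℝ).hasFDerivAt.comp_hasDerivAt t h

/-- Along the flow the energy changes at the rate `T x' ^ 2`. -/
lemma hasDerivAt_lienardEnergy {T D a b t : ℝ} {γ : ℝ → ℝ × ℝ}
    (h : HasDerivAt γ (T * (γ t).1 - (γ t).2 + b, D * (γ t).1 - a) t) :
    HasDerivAt (fun s => lienardEnergy T D a b (γ s)) (T * (T * (γ t).1 - (γ t).2 + b) ^ 2) t := by
  have hx := h.prod_fst
  have hy := h.prod_snd
  unfold lienardEnergy
  refine (((((((hx.const_mul T).sub hy).add_const b).pow 2).div_const 2).add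
    (((hx.pow 2).const_mul D).div_const 2)).sub (hx.const_mul a)).congr_deriv ?_
  simp only [Nat.cast_ofNat, Nat.add_one_sub_one, pow_one, Pi.sub_apply]
  ring

/-- The equation is needed only after `t`; continuity of `γ` extends the bound to `t`, so `t` may be
a crossing point. -/
lemma lienardEnergy_eventually_le_nhdsGT {σ T D a b t : ℝ} {γ : ℝ → ℝ × ℝ} (hγ : Continuous γ)
    (hT : 0 ≤ σ * T)
    (h : ∀ᶠ s in 𝓝[>] t, HasDerivAt γ (T * (γ s).1 - (γ s).2 + b, D * (γ s).1 - a) s) :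
    ∀ᶠ s in 𝓝[>] t, σ * lienardEnergy T D a b (γ t) ≤ σ * lienardEnergy T D a b (γ s) := by
  obtain ⟨u, hu, hsub⟩ := mem_nhdsGT_iff_exists_Ioo_subset.1 h
  filter_upwards [Ioo_mem_nhdsGT hu] with s hs
  have hmono : MonotoneOn (fun r => σ * lienardEnergy T D a b (γ r)) (Set.Icc t s) := by
    refine monotoneOn_of_hasDerivWithinAt_nonneg
      (f' := fun r => σ * (T * (T * (γ r).1 - (γ r).2 + b) ^ 2)) (convex_Icc t s)
      (((continuous_lienardEnergy T D a b).comp hγ).const_mul σ).continuousOn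
      (fun r hr => ?_) (fun r _ => ?_)
    · rw [interior_Icc] at hr
      exact ((hasDerivAt_lienardEnergy
        (hsub ⟨hr.1, hr.2.trans hs.2⟩)).const_mul σ).hasDerivWithinAt
    · rw [← mul_assoc]
      positivity
  exact hmono (Set.left_mem_Icc.2 hs.1.le) (Set.right_mem_Icc.2 hs.1.le) hs.1.le

lemma lienardEnergy_eventually_le_nhdsLT {σ T D a b t : ℝ} {γ : ℝ → ℝ × ℝ} (hγ : Continuous γ)
    (hT : 0 ≤ σ * T)
    (h : ∀ᶠ s in 𝓝[<] t, HasDerivAt γ (T * (γ s).1 - (γ s).2 + b, D * (γ s).1 - a) s) :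
    ∀ᶠ s in 𝓝[<] t, σ * lienardEnergy T D a b (γ s) ≤ σ * lienardEnergy T D a b (γ t) := by
  obtain ⟨u, hu, hsub⟩ := mem_nhdsLT_iff_exists_Ioo_subset.1 h
  filter_upwards [Ioo_mem_nhdsLT hu] with s hs
  have hmono : MonotoneOn (fun r => σ * lienardEnergy T D a b (γ r)) (Set.Icc s t) := by
    refine monotoneOn_of_hasDerivWithinAt_nonneg
      (f' := fun r => σ * (T * (T * (γ r).1 - (γ r).2 + b) ^ 2)) (convex_Icc s t)
      (((continuous_lienardEnergy T D a b).comp hγ).const_mul σ).continuousOn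
      (fun r hr => ?_) (fun r _ => ?_)
    · rw [interior_Icc] at hr
      exact ((hasDerivAt_lienardEnergy
        (hsub ⟨hs.1.trans hr.1, hr.2⟩)).const_mul σ).hasDerivWithinAt
    · rw [← mul_assoc]
      positivity
  exact hmono (Set.left_mem_Icc.2 hs.2.le) (Set.right_mem_Icc.2 hs.2.le) hs.2.le

/-- If the energy is constant on an arc that accumulates at a point with `x' ≠ 0`, then the trace
vanishes. -/
lemma trace_eq_zero_of_energy_const {T D a b c t : ℝ} {γ : ℝ → ℝ × ℝ} {l : Filter ℝ} [l.NeBot]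
    (hl : l ≤ 𝓝 t) (hγ : ContinuousAt γ t) (hne : T * (γ t).1 - (γ t).2 + b ≠ 0)
    (h : ∀ᶠ s in l, HasDerivAt γ (T * (γ s).1 - (γ s).2 + b, D * (γ s).1 - a) s ∧
      ∀ᶠ r in 𝓝 s, lienardEnergy T D a b (γ r) = c) : T = 0 := by
  have hcont : ContinuousAt (fun s => T * (γ s).1 - (γ s).2 + b) t := by fun_prop
  obtain ⟨s, ⟨hs, hconst⟩, hs0⟩ := (h.and (hl (hcont.eventually_ne hne))).exists
  have h0 : HasDerivAt (fun r => lienardEnergy T D a b (γ r)) 0 s :=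
    (hasDerivAt_const s c).congr_of_eventuallyEq hconst
  have := (hasDerivAt_lienardEnergy hs).unique h0
  simpa [hs0] using this

/-! ### Energy along crossing solutions -/

namespace PiecewiseLienard

variable {S : PiecewiseLienard} {γ : ℝ → ℝ × ℝ}

/-- The energy of the zone that contains the point; the right zone is taken to be closed. -/
noncomputable def energy (S : PiecewiseLienard) (q : ℝ × ℝ) : ℝ :=
  if q.1 < 0 then lienardEnergy S.TL S.DL S.aL 0 q else lienardEnergy S.TR S.DR S.aR S.b q

lemma energy_of_neg {q : ℝ × ℝ} (hq : q.1 < 0) :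
    S.energy q = lienardEnergy S.TL S.DL S.aL 0 q := if_pos hq

lemma energy_of_nonneg {q : ℝ × ℝ} (hq : 0 ≤ q.1) :
    S.energy q = lienardEnergy S.TR S.DR S.aR S.b q := if_neg (not_lt.2 hq)

namespace IsCrossingSolution

lemma continuous (h : S.IsCrossingSolution γ) : Continuous γ := by
  refine continuous_iff_continuousAt.2 fun t => ?_
  rcases lt_trichotomy (γ t).1 0 with hx | hx | hx
  · exact (h.left t hx).continuousAt
  · refine continuousAt_iff_continuous_left_right.2 ?_
    rcases h.cross t hx with ⟨-, h1, h2⟩ | ⟨-, h1, h2⟩ <;>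
      exact ⟨h1.continuousWithinAt, h2.continuousWithinAt⟩
  · exact (h.right t hx).continuousAt

lemma hasDerivAt_left (h : S.IsCrossingSolution γ) {t : ℝ} (ht : (γ t).1 < 0) :
    HasDerivAt γ (S.TL * (γ t).1 - (γ t).2 + 0, S.DL * (γ t).1 - S.aL) t := by
  simpa [leftField] using h.left t ht

/-- Above the sliding segment the curve passes from the right zone to the left zone. -/
lemma eventually_of_top (h : S.IsCrossingSolution γ) {t : ℝ} (hx : (γ t).1 = 0)
    (hy : max 0 S.b < (γ t).2) :
    (∀ᶠ s in 𝓝[<] t, 0 < (γ s).1) ∧ ∀ᶠ s in 𝓝[>] t, (γ s).1 < 0 := by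
  obtain ⟨h0, hb⟩ := max_lt_iff.1 hy
  rcases h.cross t hx with ⟨-, h1, h2⟩ | ⟨h3, -, -⟩
  · constructor
    -- Here `x` decreases through zero, so the sign lemmas are applied to `-x`.
    · have := h1.prod_fst.neg.eventually_neg_nhdsLT (by simp [hx])
        (by simp only [rightField, hx]; linarith)
      simpa using this
    · have := h2.prod_fst.neg.eventually_pos_nhdsGT (by simp [hx])
        (by simp only [leftField, hx]; linarith)
      simpa using this
  · exact absurd h0 (not_lt.2 (h3.trans_le (min_le_left _ _)).le)

/-- Below the sliding segment the curve passes from the left zone to the right zone. -/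
lemma eventually_of_bottom (h : S.IsCrossingSolution γ) {t : ℝ} (hx : (γ t).1 = 0)
    (hy : (γ t).2 < min 0 S.b) :
    (∀ᶠ s in 𝓝[<] t, (γ s).1 < 0) ∧ ∀ᶠ s in 𝓝[>] t, 0 < (γ s).1 := by
  obtain ⟨h0, hb⟩ := lt_min_iff.1 hy
  rcases h.cross t hx with ⟨h3, -, -⟩ | ⟨-, h1, h2⟩
  · exact absurd h0 (not_lt.2 ((le_max_left _ _).trans_lt h3).le)
  · exact ⟨h1.prod_fst.eventually_neg_nhdsLT hx (by simp only [leftField, hx]; linarith),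
      h2.prod_fst.eventually_pos_nhdsGT hx (by simp only [rightField, hx]; linarith)⟩

lemma energy_eventually_le_nhdsGT_of_neg (h : S.IsCrossingSolution γ) {σ t : ℝ}
    (hL : 0 ≤ σ * S.TL) (hx : ∀ᶠ s in 𝓝[>] t, (γ s).1 < 0) :
    ∀ᶠ s in 𝓝[>] t, σ * lienardEnergy S.TL S.DL S.aL 0 (γ t) ≤ σ * S.energy (γ s) := by
  filter_upwards [hx, lienardEnergy_eventually_le_nhdsGT h.continuous hL
    (hx.mono fun s hs => h.hasDerivAt_left hs)] with s hs hs'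
  rwa [energy_of_neg hs]

lemma energy_eventually_le_nhdsLT_of_neg (h : S.IsCrossingSolution γ) {σ t : ℝ}
    (hL : 0 ≤ σ * S.TL) (hx : ∀ᶠ s in 𝓝[<] t, (γ s).1 < 0) :
    ∀ᶠ s in 𝓝[<] t, σ * S.energy (γ s) ≤ σ * lienardEnergy S.TL S.DL S.aL 0 (γ t) := by
  filter_upwards [hx, lienardEnergy_eventually_le_nhdsLT h.continuous hL
    (hx.mono fun s hs => h.hasDerivAt_left hs)] with s hs hs'
  rwa [energy_of_neg hs]

lemma energy_eventually_le_nhdsGT_of_pos (h : S.IsCrossingSolution γ) {σ t : ℝ}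
    (hR : 0 ≤ σ * S.TR) (hx : ∀ᶠ s in 𝓝[>] t, 0 < (γ s).1) :
    ∀ᶠ s in 𝓝[>] t, σ * lienardEnergy S.TR S.DR S.aR S.b (γ t) ≤ σ * S.energy (γ s) := by
  filter_upwards [hx, lienardEnergy_eventually_le_nhdsGT h.continuous hR
    (hx.mono fun s hs => h.right s hs)] with s hs hs'
  rwa [energy_of_nonneg hs.le]

lemma energy_eventually_le_nhdsLT_of_pos (h : S.IsCrossingSolution γ) {σ t : ℝ}
    (hR : 0 ≤ σ * S.TR) (hx : ∀ᶠ s in 𝓝[<] t, 0 < (γ s).1) :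
    ∀ᶠ s in 𝓝[<] t, σ * S.energy (γ s) ≤ σ * lienardEnergy S.TR S.DR S.aR S.b (γ t) := by
  filter_upwards [hx, lienardEnergy_eventually_le_nhdsLT h.continuous hR
    (hx.mono fun s hs => h.right s hs)] with s hs hs'
  rwa [energy_of_nonneg hs.le]

/-- If the traces and `b` have the sign of `σ`, then `σ` times the energy is nondecreasing along a
crossing solution: inside a zone its rate is `σ T x' ^ 2`, and each crossing adds
`σ b |y - b / 2|`. -/
lemma monotone_energy (h : S.IsCrossingSolution γ) {σ : ℝ} (hL : 0 ≤ σ * S.TL)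
    (hR : 0 ≤ σ * S.TR) (hb : 0 ≤ σ * S.b) : Monotone fun t => σ * S.energy (γ t) := by
  suffices H : ∀ t, (∀ᶠ s in 𝓝[<] t, σ * S.energy (γ s) ≤ σ * S.energy (γ t)) ∧
      ∀ᶠ s in 𝓝[>] t, σ * S.energy (γ t) ≤ σ * S.energy (γ s) from
    monotone_of_eventually_le (fun t => (H t).1) fun t => (H t).2
  intro t
  have hcont : ContinuousAt (fun s => (γ s).1) t := h.continuous.fst.continuousAt
  rcases lt_trichotomy (γ t).1 0 with hx | hx | hx
  · have hev := hcont.eventually_lt_const hx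
    rw [energy_of_neg hx]
    exact ⟨h.energy_eventually_le_nhdsLT_of_neg hL (hev.filter_mono nhdsWithin_le_nhds),
      h.energy_eventually_le_nhdsGT_of_neg hL (hev.filter_mono nhdsWithin_le_nhds)⟩
  · have hjump : σ * lienardEnergy S.TL S.DL S.aL 0 (γ t) -
        σ * lienardEnergy S.TR S.DR S.aR S.b (γ t) = σ * S.b * ((γ t).2 - S.b / 2) := by
      simp only [lienardEnergy, hx]
      ring
    -- At the crossing `energy` takes its right-zone value, so the jump falls on the left-zone side:
    -- after `t` at the top, before `t` at the bottom.
    rw [energy_of_nonneg hx.ge]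
    rcases h.cross t hx with ⟨hy, -, -⟩ | ⟨hy, -, -⟩
    · obtain ⟨hl, hr⟩ := h.eventually_of_top hx hy
      obtain ⟨h0, h1⟩ := max_lt_iff.1 hy
      refine ⟨h.energy_eventually_le_nhdsLT_of_pos hR hl, ?_⟩
      have : 0 ≤ σ * S.b * ((γ t).2 - S.b / 2) := mul_nonneg hb (by linarith)
      filter_upwards [h.energy_eventually_le_nhdsGT_of_neg hL hr] with s hs
      linarith
    · obtain ⟨hl, hr⟩ := h.eventually_of_bottom hx hy
      obtain ⟨h0, h1⟩ := lt_min_iff.1 hy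
      refine ⟨?_, h.energy_eventually_le_nhdsGT_of_pos hR hr⟩
      have : σ * S.b * ((γ t).2 - S.b / 2) ≤ 0 := mul_nonpos_of_nonneg_of_nonpos hb (by linarith)
      filter_upwards [h.energy_eventually_le_nhdsLT_of_neg hL hl] with s hs
      linarith
  · have hev := hcont.eventually_const_lt hx
    rw [energy_of_nonneg hx.le]
    exact ⟨h.energy_eventually_le_nhdsLT_of_pos hR (hev.filter_mono nhdsWithin_le_nhds),
      h.energy_eventually_le_nhdsGT_of_pos hR (hev.filter_mono nhdsWithin_le_nhds)⟩

/-- A crossing solution of constant energy that meets `x = 0` forces both traces to vanish. -/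
lemma traces_eq_zero_of_energy_const (h : S.IsCrossingSolution γ) {c t : ℝ}
    (hc : ∀ s, S.energy (γ s) = c) (hx : (γ t).1 = 0) : S.TL = 0 ∧ S.TR = 0 := by
  have hL : ∀ s, (γ s).1 < 0 →
      HasDerivAt γ (S.TL * (γ s).1 - (γ s).2 + 0, S.DL * (γ s).1 - S.aL) s ∧
      ∀ᶠ r in 𝓝 s, lienardEnergy S.TL S.DL S.aL 0 (γ r) = c := fun s hs => by
    refine ⟨h.hasDerivAt_left hs, ?_⟩
    filter_upwards [h.continuous.fst.continuousAt.eventually_lt_const hs] with r hr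
    rw [← energy_of_neg hr, hc]
  have hR : ∀ s, 0 < (γ s).1 →
      HasDerivAt γ (S.TR * (γ s).1 - (γ s).2 + S.b, S.DR * (γ s).1 - S.aR) s ∧
      ∀ᶠ r in 𝓝 s, lienardEnergy S.TR S.DR S.aR S.b (γ r) = c := fun s hs => by
    refine ⟨h.right s hs, ?_⟩
    filter_upwards [h.continuous.fst.continuousAt.eventually_const_lt hs] with r hr
    rw [← energy_of_nonneg hr.le, hc]
  have hγ : ContinuousAt γ t := h.continuous.continuousAt
  rcases h.cross t hx with ⟨hy, -, -⟩ | ⟨hy, -, -⟩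
  · obtain ⟨hl, hr⟩ := h.eventually_of_top hx hy
    obtain ⟨h0, h1⟩ := max_lt_iff.1 hy
    exact ⟨trace_eq_zero_of_energy_const nhdsWithin_le_nhds hγ
        (by rw [hx]; exact ne_of_lt (by linarith)) (hr.mono hL),
      trace_eq_zero_of_energy_const nhdsWithin_le_nhds hγ
        (by rw [hx]; exact ne_of_lt (by linarith)) (hl.mono hR)⟩
  · obtain ⟨hl, hr⟩ := h.eventually_of_bottom hx hy
    obtain ⟨h0, h1⟩ := lt_min_iff.1 hy
    exact ⟨trace_eq_zero_of_energy_const nhdsWithin_le_nhds hγ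
        (by rw [hx]; exact ne_of_gt (by linarith)) (hl.mono hL),
      trace_eq_zero_of_energy_const nhdsWithin_le_nhds hγ
        (by rw [hx]; exact ne_of_gt (by linarith)) (hr.mono hR)⟩

end IsCrossingSolution

/-- The traces and `b` have a common weak sign. -/
lemma exists_common_sign (hT : 0 ≤ S.TL * S.TR)
    (h : (S.TL ≠ 0 ∧ 0 ≤ S.TL * S.b) ∨ (S.TR ≠ 0 ∧ 0 ≤ S.TR * S.b)) :
    ∃ σ : ℝ, σ ≠ 0 ∧ 0 ≤ σ * S.TL ∧ 0 ≤ σ * S.TR ∧ 0 ≤ σ * S.b := by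
  rcases h with ⟨h0, hb⟩ | ⟨h0, hb⟩
  -- The nonzero trace itself serves as `σ`.
  · exact ⟨S.TL, h0, mul_self_nonneg _, hT, hb⟩
  · exact ⟨S.TR, h0, by rwa [mul_comm], mul_self_nonneg _, hb⟩

end PiecewiseLienard

theorem corollary9 (S : PiecewiseLienard) (hT : 0 ≤ S.TL * S.TR)
    (h : (S.TL ≠ 0 ∧ 0 ≤ S.TL * S.b) ∨ (S.TR ≠ 0 ∧ 0 ≤ S.TR * S.b)) :
    ¬ ∃ O : Set (ℝ × ℝ), S.IsCrossingPeriodicOrbit O := by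
  rintro ⟨O, γ, p, hp, hper, hγ, ⟨t, hx⟩, -⟩
  obtain ⟨σ, hσ, hL, hR, hb⟩ := PiecewiseLienard.exists_common_sign hT h
  have hconst : ∀ s, S.energy (γ s) = S.energy (γ t) := fun s =>
    mul_left_cancel₀ hσ ((hγ.monotone_energy hL hR hb).eq_of_periodic hp
      (fun r => by simp only [hper r]) s t)
  obtain ⟨hTL, hTR⟩ := hγ.traces_eq_zero_of_energy_const hconst hx
  rcases h with ⟨h0, -⟩ | ⟨h0, -⟩
  · exact h0 hTL
  · exact h0 hTR
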